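/- Let $G$ be a topologically finitely generated prosolvable group. Suppose there exists $\gamma\in\mathbb N$ such that $\dim_{\operatorname{End}_G(V)}V\le\gamma$ for every irreducible $G$-module $V$ that is $G$-isomorphic to a complemented chief factor of $G$. Then $c_n(G)$ is polynomially bounded: there exists $\beta$, independent of $n$, such that $c_n(G)\le n^\beta$ for all $n\ge 1$, where $c_n(G)$ is the number of open subgroups of $G$ of index $n$ that are intersections of maximal subgroups of $G$. (Here a chief factor of $G$ is a quotient $H/K$, where $K<H$ are closed normal subgroups of $G$ with no closed normal subgroup of $G$ strictly between them, regarded as a $G$-module via conjugation; it is complemented if there is a closed subgroup $U\le G$ with $UH=G$ and $U\cap H=K$. A group is prosolvable if it is profinite and all its quotients by open normal subgroups are solvable.) -/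

import Mathlib

universe u

/-- `G` is topologically finitely generated: some finite subset generates a dense subgroup. -/
def IsTopologicallyFG (G : Type u) [Group G] [TopologicalSpace G] : Prop :=
  ∃ S : Finset G, Dense ((Subgroup.closure (S : Set G) : Subgroup G) : Set G)

/-- A profinite group: a compact, Hausdorff, totally disconnected topological group. -/
structure IsProfiniteGroup (G : Type u) [Group G] [TopologicalSpace G] : Prop where
  isTopologicalGroup : IsTopologicalGroup G
  compactSpace : CompactSpace G
  t2Space : T2Space G
  totallyDisconnectedSpace : TotallyDisconnectedSpace G

/-- A prosolvable group: a profinite group whose quotients by open normal subgroups are all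
solvable. -/
structure IsProsolvable (G : Type u) [Group G] [TopologicalSpace G] : Prop
    extends IsProfiniteGroup G where
  isSolvable_quotient : ∀ (N : Subgroup G) [N.Normal], IsOpen (N : Set G) → Group.IsSolvable (G ⧸ N)

/-- `H / K` is a chief factor of the topological group `G`: `K < H` are closed normal subgroups
of `G` and no closed normal subgroup of `G` lies strictly between them. -/
structure IsChiefFactor {G : Type u} [Group G] [TopologicalSpace G] (H K : Subgroup G) :
    Prop where
  normal_top : H.Normal
  normal_bot : K.Normal
  isClosed_top : IsClosed (H : Set G)
  isClosed_bot : IsClosed (K : Set G)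
  lt : K < H
  eq_or_eq : ∀ L : Subgroup G, L.Normal → IsClosed (L : Set G) → K ≤ L → L ≤ H → L = K ∨ L = H

/-- `H / K` is complemented in `G / K`: there is a closed subgroup `U` with `U H = G` and
`U ∩ H = K` (as `H` is normal, the set `U H` is the join of `U` and `H`). -/
def IsComplementedFactor {G : Type u} [Group G] [TopologicalSpace G] (H K : Subgroup G) : Prop :=
  ∃ U : Subgroup G, IsClosed (U : Set G) ∧ U ⊔ H = ⊤ ∧ U ⊓ H = K

/-- The `G`-module `V`, i.e. the `ℤ[G]`-module `V`, is `G`-isomorphic to `H / K`, on which `G` acts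
by conjugation. -/
def IsGIsomorphicToFactor {G : Type u} [Group G] (H K : Subgroup G) [H.Normal] [K.Normal]
    (V : Type u) [AddCommGroup V] [Module (MonoidAlgebra ℤ G) V] : Prop :=
  ∃ e : (H ⧸ K.subgroupOf H) ≃* Multiplicative V, ∀ (g : G) (h : H),
    (e (QuotientGroup.mk (MulAut.conjNormal g h))).toAdd =
      MonoidAlgebra.of ℤ G g • (e (QuotientGroup.mk h)).toAdd

/-- The open subgroups of index `n` that are intersections of maximal subgroups of `G`; the group
`G` itself is the intersection of the empty family. (Subgroups containing an open subgroup are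
open, so the maximal subgroups in question are automatically open.) -/
def maximalIntersections (G : Type u) [Group G] [TopologicalSpace G] (n : ℕ) :
    Set (Subgroup G) :=
  {H | IsOpen (H : Set G) ∧ H.index = n ∧
    ∃ S : Set (Subgroup G), (∀ M ∈ S, IsCoatom M) ∧ H = sInf S}

/-- `c_n(G)`, the number of open subgroups of index `n` that are intersections of maximal
subgroups, as an extended natural number. -/
noncomputable def maximalIntersectionCount (G : Type u) [Group G] [TopologicalSpace G] (n : ℕ) :
    ℕ∞ :=
  (maximalIntersections G n).encard

/-! It suffices to bound finite families of the subgroups being counted. Some open normal `N` lies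
in every member, so all takes place along a chief series from `N` to `G`, whose factors are abelian;
the bound must not depend on `N`. A maximal subgroup above `N` complements exactly one factor `V`,
where it is the zero set of a crossed homomorphism to `V`. With `d` generators there are at most
`|V|^d` of these, in a space of dimension at most `dγ` over `End V`, so any intersection of
complements of one factor is an intersection of `dγ + 1` of them.

If `U` has index `n`, the factors complemented by maximal subgroups above `U` have orders with
product at most `n` (`prod_relIndex_le_index`). Given this set `I` of factors, `U` is determined by
`dγ + 1` complements of each, so there are at most `∏ w_i^(d(dγ+1))` such `U`, where `w_i` are the
orders.

To sum over `I`, the number of complemented factors of order `m` must be polynomial in `m`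
(`card_filter_relIndex_eq_le`). Here `γ` enters again: a complement is a point stabilizer in an
affine action on `L^r` with `r ≤ γ`, and such actions are few because matrices of bounded size are
few. An Euler product estimate (`sum_prod_pow_le`) finishes the count. -/

/-! ### Abelian chief factors, their complements and crossed homomorphisms -/

section ChiefPairs

variable {G : Type u} [Group G]

/-- `K < H` are consecutive in the lattice of normal subgroups of `G`. -/
def IsChiefPair (K H : Subgroup G) : Prop :=
  K < H ∧ ∀ L : Subgroup G, L.Normal → K ≤ L → L ≤ H → L = K ∨ L = H

/-- The maximal subgroups of `G` that contain `K` but not `H`. -/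
def maximalComplements (K H : Subgroup G) : Set (Subgroup G) :=
  {M | IsCoatom M ∧ K ≤ M ∧ ¬ H ≤ M}

lemma sup_eq_top_of_mem_maximalComplements {K H M : Subgroup G}
    (hM : M ∈ maximalComplements K H) : M ⊔ H = ⊤ :=
  hM.1.2 _ (lt_of_le_of_ne le_sup_left fun h => hM.2.2 (h ▸ le_sup_right))

/-- `M ⊓ H` is normalized by `M`, and also by `H` because `⁅H, H⁆ ≤ K ≤ M`. Hence it is normal in `M
⊔ H = ⊤`, and minimality of the factor applies. -/
lemma inf_eq_of_mem_maximalComplements {K H M : Subgroup G} [H.Normal]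
    (hc : IsChiefPair K H) (hab : ⁅H, H⁆ ≤ K) (hM : M ∈ maximalComplements K H) :
    M ⊓ H = K := by
  have hn : (M ⊓ H).Normal := by
    rw [← Subgroup.normalizer_eq_top_iff, eq_top_iff, ← sup_eq_top_of_mem_maximalComplements hM]
    refine sup_le ?_ ?_
    · intro m hm
      rw [Subgroup.mem_normalizer_iff]
      intro x
      simp only [Subgroup.mem_inf]
      refine and_congr ?_ ?_
      · rw [Subgroup.mul_mem_cancel_right _ (inv_mem hm), Subgroup.mul_mem_cancel_left _ hm]
      · exact ⟨fun hx => ‹H.Normal›.conj_mem x hx m, fun hx => by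
          simpa [mul_assoc] using ‹H.Normal›.conj_mem _ hx m⁻¹⟩
    · have key : ∀ h ∈ H, ∀ x ∈ M ⊓ H, h * x * h⁻¹ ∈ M ⊓ H := by
        intro h hh x hx
        refine ⟨?_, ‹H.Normal›.conj_mem x hx.2 h⟩
        have h2 := mul_mem (hM.2.1 (hab (Subgroup.commutator_mem_commutator hh hx.2))) hx.1
        simpa [commutatorElement_def] using h2
      intro h hh
      rw [Subgroup.mem_normalizer_iff]
      exact fun x => ⟨key h hh x, fun hx => by
        simpa [mul_assoc] using key h⁻¹ (inv_mem hh) _ hx⟩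
  rcases hc.2 _ hn (le_inf hM.2.1 hc.1.le) inf_le_right with h | h
  · exact h
  · exact absurd (inf_eq_right.mp h) hM.2.2

/-- An abelian normal section is `G`-isomorphic to a `ℤ[G]`-module. -/
lemma exists_module_isGIsomorphicToFactor (H K : Subgroup G) [H.Normal] [K.Normal]
    (hab : ⁅H, H⁆ ≤ K) :
    ∃ (V : Type u) (_ : AddCommGroup V) (_ : Module (MonoidAlgebra ℤ G) V),
      IsGIsomorphicToFactor H K V := by
  have hcomm : ∀ a b : H ⧸ K.subgroupOf H, a * b = b * a := by
    intro a b
    induction a using QuotientGroup.induction_on with | H a => ?_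
    induction b using QuotientGroup.induction_on with | H b => ?_
    rw [← QuotientGroup.mk_mul, ← QuotientGroup.mk_mul, QuotientGroup.eq]
    rw [Subgroup.mem_subgroupOf]
    have := hab (Subgroup.commutator_mem_commutator (inv_mem b.2) (inv_mem a.2))
    simpa [commutatorElement_def, mul_assoc] using this
  let : CommGroup (H ⧸ K.subgroupOf H) := { (inferInstance : Group _) with mul_comm := hcomm }
  let φ : G → (H ⧸ K.subgroupOf H) →* (H ⧸ K.subgroupOf H) := fun g =>
    QuotientGroup.map _ _ (MulAut.conjNormal g : MulAut H).toMonoidHom (by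
      intro x hx
      rw [Subgroup.mem_subgroupOf] at hx
      rw [Subgroup.mem_comap, Subgroup.mem_subgroupOf]
      simpa using ‹K.Normal›.conj_mem _ hx g)
  have hφ : ∀ (g : G) (h : H), φ g (QuotientGroup.mk h) = QuotientGroup.mk (MulAut.conjNormal g h) :=
    fun g h => rfl
  let ρ : G →* Module.End ℤ (Additive (H ⧸ K.subgroupOf H)) :=
    { toFun := fun g => (MonoidHom.toAdditive (φ g)).toIntLinearMap
      map_one' := by
        ext x
        induction x using Additive.rec with | ofMul x => ?_
        induction x using QuotientGroup.induction_on with | H x => ?_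
        change Additive.ofMul (φ 1 x) = _
        rw [hφ, map_one]; rfl
      map_mul' := fun g g' => by
        ext x
        induction x using Additive.rec with | ofMul x => ?_
        induction x using QuotientGroup.induction_on with | H x => ?_
        change Additive.ofMul (φ (g * g') x) = Additive.ofMul (φ g (φ g' x))
        rw [hφ, hφ, hφ, map_mul]; rfl }
  let : Module (MonoidAlgebra ℤ G) (Additive (H ⧸ K.subgroupOf H)) :=
    Module.compHom _ (MonoidAlgebra.lift ℤ _ G ρ).toRingHom
  refine ⟨Additive (H ⧸ K.subgroupOf H), inferInstance, inferInstance, MulEquiv.refl _, ?_⟩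
  intro g h
  change _ = (MonoidAlgebra.lift ℤ _ G ρ (MonoidAlgebra.of ℤ G g)) _
  rw [MonoidAlgebra.lift_of]
  rfl

lemma IsGIsomorphicToFactor.exists_map {H K : Subgroup G} [H.Normal] [K.Normal]
    {V : Type u} [AddCommGroup V] [Module (MonoidAlgebra ℤ G) V]
    (hV : IsGIsomorphicToFactor H K V) :
    ∃ q : H →* Multiplicative V, Function.Surjective q ∧ (∀ h : H, q h = 1 ↔ (h : G) ∈ K) ∧
      ∀ (g : G) (h : H), (q (MulAut.conjNormal g h)).toAdd =
        MonoidAlgebra.of ℤ G g • (q h).toAdd := by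
  obtain ⟨e, he⟩ := hV
  refine ⟨e.toMonoidHom.comp (QuotientGroup.mk' _),
    e.surjective.comp (QuotientGroup.mk'_surjective _), fun h => ?_, he⟩
  change e (QuotientGroup.mk h) = 1 ↔ _
  rw [EmbeddingLike.map_eq_one_iff, QuotientGroup.eq_one_iff, Subgroup.mem_subgroupOf]

lemma IsGIsomorphicToFactor.natCard_eq {H K : Subgroup G} [H.Normal] [K.Normal]
    {V : Type u} [AddCommGroup V] [Module (MonoidAlgebra ℤ G) V]
    (hV : IsGIsomorphicToFactor H K V) : Nat.card V = K.relIndex H := by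
  obtain ⟨e, -⟩ := hV
  exact (Nat.card_congr (e.toEquiv.trans Multiplicative.toAdd)).symm

/-- Submodules pull back to normal subgroups between `K` and `H`. -/
lemma IsChiefPair.isSimpleModule {H K : Subgroup G} [H.Normal] [K.Normal]
    {V : Type u} [AddCommGroup V] [Module (MonoidAlgebra ℤ G) V]
    (hc : IsChiefPair K H) (hV : IsGIsomorphicToFactor H K V) :
    IsSimpleModule (MonoidAlgebra ℤ G) V := by
  obtain ⟨q, hsurj, hker, hq⟩ := hV.exists_map
  have : Nontrivial V := by
    obtain ⟨h, hh, hk⟩ := SetLike.exists_of_lt hc.1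
    refine ⟨(q ⟨h, hh⟩).toAdd, 0, fun h0 => hk ((hker ⟨h, hh⟩).mp ?_)⟩
    exact h0
  rw [isSimpleModule_iff]
  refine { eq_bot_or_eq_top := ?_ }
  intro W
  let L : Subgroup G := (W.toAddSubgroup.toSubgroup.comap q).map H.subtype
  have hL : ∀ h : H, (h : G) ∈ L ↔ (q h).toAdd ∈ W := by
    intro h
    constructor
    · rintro ⟨x, hx, hxh⟩
      obtain rfl : x = h := Subtype.ext hxh
      exact hx
    · exact fun hx => ⟨h, hx, rfl⟩
  have hLH : L ≤ H := by
    rintro _ ⟨x, -, rfl⟩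
    exact x.2
  have hLn : L.Normal := ⟨fun x hx g => by
    have h1 := (hL ⟨x, hLH hx⟩).mp hx
    have h2 := W.smul_mem (MonoidAlgebra.of ℤ G g) h1
    rw [← hq, ← hL] at h2
    simpa using h2⟩
  have hKL : K ≤ L := fun k hk =>
    (hL ⟨k, hc.1.le hk⟩).mpr (by rw [(hker ⟨k, hc.1.le hk⟩).mpr hk]; exact W.zero_mem)
  rcases hc.2 L hLn hKL hLH with h | h
  · left
    rw [eq_bot_iff]
    intro v hv
    obtain ⟨x, hx⟩ := hsurj (Multiplicative.ofAdd v)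
    have h1 : (x : G) ∈ L := (hL x).mpr (by rw [hx]; exact hv)
    rw [h, ← hker, hx] at h1
    exact h1
  · right
    rw [eq_top_iff]
    intro v _
    obtain ⟨x, hx⟩ := hsurj (Multiplicative.ofAdd v)
    have h1 := (hL x).mp (by rw [h]; exact x.2)
    rw [hx] at h1
    exact h1

/-- Crossed homomorphisms from `G` to a `ℤ[G]`-module. -/
def IsCrossedHom {V : Type u} [AddCommGroup V] [Module (MonoidAlgebra ℤ G) V] (π : G → V) : Prop :=
  ∀ g h : G, π (g * h) = π g + MonoidAlgebra.of ℤ G g • π h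

/-- A maximal subgroup avoiding an abelian chief factor is the zero set of a crossed homomorphism
to that factor. -/
lemma exists_isCrossedHom_of_mem_maximalComplements {H K M : Subgroup G} [H.Normal] [K.Normal]
    {V : Type u} [AddCommGroup V] [Module (MonoidAlgebra ℤ G) V]
    (hc : IsChiefPair K H) (hab : ⁅H, H⁆ ≤ K) (hV : IsGIsomorphicToFactor H K V)
    (hM : M ∈ maximalComplements K H) :
    ∃ π : G → V, IsCrossedHom π ∧ ∀ g, π g = 0 ↔ g ∈ M := by
  obtain ⟨q, hsurj, hker, hq⟩ := hV.exists_map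
  have hinf := inf_eq_of_mem_maximalComplements hc hab hM
  -- Write `g = v m` with `v ∈ H`, `m ∈ M`; the class of `v` modulo `K = M ⊓ H` is well defined and
  -- will be `π g`.
  have hex : ∀ g : G, ∃ v : H, (v : G)⁻¹ * g ∈ M := by
    intro g
    have hg : g ∈ H ⊔ M := by
      rw [sup_comm, sup_eq_top_of_mem_maximalComplements hM]; trivial
    obtain ⟨v, hv, m, hm, rfl⟩ := Subgroup.mem_sup_of_normal_left.mp hg
    exact ⟨⟨v, hv⟩, by simpa using hm⟩
  choose v hv using hex
  have huniq : ∀ (g : G) (w : H), (w : G)⁻¹ * g ∈ M → q (v g) = q w := by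
    intro g w hw
    have h1 : (((w⁻¹ * v g : H)) : G) ∈ K := by
      rw [← hinf]
      refine ⟨?_, (w⁻¹ * v g).2⟩
      have := mul_mem hw (inv_mem (hv g))
      simpa [mul_assoc] using this
    rw [← hker, map_mul, map_inv, inv_mul_eq_one] at h1
    exact h1.symm
  refine ⟨fun g => (q (v g)).toAdd, fun g h => ?_, fun g => ⟨fun h0 => ?_, fun hg => ?_⟩⟩
  · have hmem : ((v g * MulAut.conjNormal (((v g : G))⁻¹ * g) (v h) : H) : G)⁻¹ * (g * h) ∈ M := by
      have := mul_mem (hv g) (hv h)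
      simpa [mul_assoc] using this
    -- `g` and `(v g)⁻¹ * g` differ by an element of `H`, which acts trivially on the abelian `H /
    -- K`.
    have hconj : q (MulAut.conjNormal (((v g : G))⁻¹ * g) (v h)) =
        q (MulAut.conjNormal g (v h)) := by
      have : MulAut.conjNormal (((v g : G))⁻¹ * g) (v h) =
          (v g)⁻¹ * MulAut.conjNormal g (v h) * v g := by
        ext; simp [mul_assoc]
      rw [this, map_mul, map_mul, map_inv]
      have hcm : ∀ a b : Multiplicative V, a * b = b * a := mul_comm
      rw [hcm _ (q (v g)), mul_inv_cancel_left]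
    simp only
    rw [huniq _ _ hmem, map_mul, hconj, toAdd_mul, hq]
  · have h1 : ((v g : H) : G) ∈ M := hM.2.1 ((hker _).mp h0)
    simpa using mul_mem h1 (hv g)
  · have := huniq g 1 (by simpa using hg)
    simp only
    rw [this, map_one, toAdd_one]

/-- Crossed homomorphisms are determined by their values on generators. -/
lemma IsCrossedHom.eq_of_eqOn {V : Type u} [AddCommGroup V] [Module (MonoidAlgebra ℤ G) V]
    {π π' : G → V} (h : IsCrossedHom π) (h' : IsCrossedHom π') {S : Set G}
    (hS : Subgroup.closure S = ⊤) (heq : Set.EqOn π π' S) : π = π' := by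
  have hone : ∀ {σ : G → V}, IsCrossedHom σ → σ 1 = 0 := by
    intro σ hσ
    have := hσ 1 1
    rw [map_one, one_smul, mul_one] at this
    simpa using this
  have hinv : ∀ {σ : G → V}, IsCrossedHom σ → ∀ x,
      σ x⁻¹ = - (MonoidAlgebra.of ℤ G x⁻¹ • σ x) := by
    intro σ hσ x
    have := hσ x⁻¹ x
    rw [inv_mul_cancel, hone hσ] at this
    exact eq_neg_of_add_eq_zero_left this.symm
  funext g
  have hg : g ∈ Subgroup.closure S := hS ▸ Subgroup.mem_top g
  induction hg using Subgroup.closure_induction with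
  | mem x hx => exact heq hx
  | one => rw [hone h, hone h']
  | mul x y _ _ hx hy => rw [h, h', hx, hy]
  | inv x _ hx => rw [hinv h, hinv h', hx]

end ChiefPairs

/-! ### Counting complements of one factor -/

section Complements

variable {G : Type u} [Group G]

lemma closure_union_eq_top {S : Set G} {N : Subgroup G} (hS : Subgroup.closure S ⊔ N = ⊤) :
    Subgroup.closure (S ∪ (N : Set G)) = ⊤ := by
  rw [Subgroup.closure_union, Subgroup.closure_eq, hS]

lemma IsGIsomorphicToFactor.smul_eq_self {H K : Subgroup G} [H.Normal] [K.Normal]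
    {V : Type u} [AddCommGroup V] [Module (MonoidAlgebra ℤ G) V]
    (hV : IsGIsomorphicToFactor H K V) {k : G} (hk : k ∈ K) (v : V) :
    MonoidAlgebra.of ℤ G k • v = v := by
  obtain ⟨q, hsurj, hker, hq⟩ := hV.exists_map
  obtain ⟨h, hh⟩ := hsurj (Multiplicative.ofAdd v)
  have h1 := hq k h
  rw [hh, toAdd_ofAdd] at h1
  rw [← h1]
  have h2 : q (MulAut.conjNormal k h * h⁻¹) = 1 := by
    rw [hker]
    have := mul_mem hk (‹K.Normal›.conj_mem _ (inv_mem hk) h)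
    simpa [mul_assoc] using this
  rw [map_mul, map_inv, mul_inv_eq_one] at h2
  rw [h2, hh, toAdd_ofAdd]

/-- The crossed homomorphisms involved vanish on `N`, so their values on `S` determine them. -/
lemma finite_and_ncard_maximalComplements_le {H K N : Subgroup G} [H.Normal] [K.Normal]
    {V : Type u} [AddCommGroup V] [Module (MonoidAlgebra ℤ G) V] [Finite V]
    (hc : IsChiefPair K H) (hab : ⁅H, H⁆ ≤ K) (hV : IsGIsomorphicToFactor H K V)
    (hNK : N ≤ K) (S : Finset G) (hS : Subgroup.closure (S : Set G) ⊔ N = ⊤) :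
    (maximalComplements K H).Finite ∧
      (maximalComplements K H).ncard ≤ Nat.card V ^ S.card := by
  choose π hπ hπM using fun M : maximalComplements K H =>
    exists_isCrossedHom_of_mem_maximalComplements hc hab hV M.2
  have hinj : Function.Injective (fun (M : maximalComplements K H) (s : S) => π M s) := by
    intro M M' h
    have : π M = π M' := (hπ M).eq_of_eqOn (hπ M') (closure_union_eq_top hS) (by
      rintro x (hx | hx)
      · exact congrFun h ⟨x, hx⟩
      · rw [(hπM M x).mpr (M.2.2.1 (hNK hx)), (hπM M' x).mpr (M'.2.2.1 (hNK hx))])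
    ext x
    rw [← hπM, ← hπM, this]
  have hfin : Finite (maximalComplements K H) := Finite.of_injective _ hinj
  refine ⟨hfin, ?_⟩
  have := Nat.card_le_card_of_injective _ hinj
  rwa [Nat.card_fun, Nat.card_eq_fintype_card (α := S), Fintype.card_coe,
    Nat.card_coe_set_eq] at this

/-- Crossed homomorphisms vanishing on `N`, as a vector space over a division ring of
endomorphisms. -/
def crossedHomSubmodule (N : Subgroup G) (F V : Type u) [DivisionRing F] [AddCommGroup V]
    [Module (MonoidAlgebra ℤ G) V] [Module F V] [SMulCommClass F (MonoidAlgebra ℤ G) V] :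
    Submodule F (G → V) where
  carrier := {π | IsCrossedHom π ∧ ∀ n ∈ N, π n = 0}
  add_mem' := by
    rintro a b ⟨ha, ha'⟩ ⟨hb, hb'⟩
    refine ⟨fun g h => ?_, fun n hn => by simp [ha' n hn, hb' n hn]⟩
    simp only [Pi.add_apply, ha g h, hb g h, smul_add]
    abel
  zero_mem' := ⟨fun g h => by simp, fun n hn => rfl⟩
  smul_mem' := by
    rintro c a ⟨ha, ha'⟩
    refine ⟨fun g h => ?_, fun n hn => by simp [ha' n hn]⟩
    simp only [Pi.smul_apply, ha g h, smul_add]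
    rw [smul_comm]

/-- Evaluation on `S` is an injective linear map to `V ^ S`. -/
lemma finrank_crossedHomSubmodule_le {N : Subgroup G} {F V : Type u} [DivisionRing F]
    [AddCommGroup V] [Module (MonoidAlgebra ℤ G) V] [Module F V]
    [SMulCommClass F (MonoidAlgebra ℤ G) V] [Module.Finite F V]
    (S : Finset G) (hS : Subgroup.closure (S : Set G) ⊔ N = ⊤) :
    Module.Finite F (crossedHomSubmodule N F V) ∧
      Module.finrank F (crossedHomSubmodule N F V) ≤ S.card * Module.finrank F V := by
  let ev : crossedHomSubmodule N F V →ₗ[F] (S → V) :=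
    (LinearMap.funLeft F V (fun s : S => (s : G))).comp (Submodule.subtype _)
  have hev : Function.Injective ev := by
    intro a b h
    refine Subtype.ext (a.2.1.eq_of_eqOn b.2.1 (closure_union_eq_top hS) ?_)
    rintro x (hx | hx)
    · exact congrFun h ⟨x, hx⟩
    · rw [a.2.2 x hx, b.2.2 x hx]
  refine ⟨Module.Finite.of_injective ev hev, ?_⟩
  have := LinearMap.finrank_le_finrank_of_injective hev
  rwa [Module.finrank_pi_fintype, Finset.sum_const, Finset.card_univ, Fintype.card_coe,
    smul_eq_mul] at this

/-- Every intersection of maximal subgroups avoiding the same abelian chief factor is the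
intersection of boundedly many of them. -/
lemma exists_iInf_eq_sInf_of_subset_maximalComplements {H K N : Subgroup G} [H.Normal] [K.Normal]
    {F V : Type u} [DivisionRing F] [AddCommGroup V] [Module (MonoidAlgebra ℤ G) V] [Module F V]
    [SMulCommClass F (MonoidAlgebra ℤ G) V] [Module.Finite F V]
    (hc : IsChiefPair K H) (hab : ⁅H, H⁆ ≤ K) (hV : IsGIsomorphicToFactor H K V)
    (hNK : N ≤ K) (S : Finset G) (hS : Subgroup.closure (S : Set G) ⊔ N = ⊤)
    {γ : ℕ} (hγ : Module.finrank F V ≤ γ)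
    {Γ : Set (Subgroup G)} (hΓ : Γ ⊆ maximalComplements K H) (hne : Γ.Nonempty) :
    ∃ f : Fin (S.card * γ + 1) → Subgroup G, (∀ j, f j ∈ Γ) ∧ ⨅ j, f j = sInf Γ := by
  obtain ⟨hfin, hrank⟩ := finrank_crossedHomSubmodule_le (F := F) (V := V) S hS
  choose π hπ hπM using fun M : Γ =>
    exists_isCrossedHom_of_mem_maximalComplements hc hab hV (hΓ M.2)
  let p : Γ → crossedHomSubmodule N F V := fun M =>
    ⟨π M, hπ M, fun n hn => (hπM M n).mpr ((hΓ M.2).2.1 (hNK hn))⟩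
  obtain ⟨b, hbs, hspan, hli⟩ := exists_linearIndependent F (Set.range p)
  have hbfin : b.Finite := hli.setFinite
  have := hbfin.fintype
  have hcard : Fintype.card b ≤ S.card * γ :=
    hli.fintype_card_le_finrank.trans (hrank.trans (Nat.mul_le_mul_left _ hγ))
  obtain ⟨M₀, hM₀⟩ := hne
  choose m hm using fun x : b => hbs x.2
  let eb := (Fintype.equivFin b).symm
  -- Indices beyond the basis repeat `M₀`, which gives all families the same length. As `M₀ ∈ Γ`,
  -- the intersection is unaffected.
  let f : Fin (S.card * γ + 1) → Γ := fun j =>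
    if h : (j : ℕ) < Fintype.card b then m (eb ⟨j, h⟩) else ⟨M₀, hM₀⟩
  refine ⟨fun j => f j, fun j => (f j).2, le_antisymm ?_ ?_⟩
  · intro g hg
    rw [Subgroup.mem_iInf] at hg
    rw [Subgroup.mem_sInf]
    intro M hM
    have hb : ∀ x ∈ b, (x : G → V) g = 0 := by
      intro x hx
      have hj := hg ⟨((eb.symm ⟨x, hx⟩ : Fin _) : ℕ), by omega⟩
      have hf : f ⟨((eb.symm ⟨x, hx⟩ : Fin _) : ℕ), by omega⟩ = m ⟨x, hx⟩ := by
        simp only [f]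
        rw [dif_pos (eb.symm ⟨x, hx⟩).2, Fin.eta, Equiv.apply_symm_apply]
      rw [hf, ← hπM] at hj
      rw [show x = p (m ⟨x, hx⟩) from (hm ⟨x, hx⟩).symm]
      exact hj
    have hsp : p ⟨M, hM⟩ ∈ Submodule.span F b := by
      rw [hspan]; exact Submodule.subset_span ⟨_, rfl⟩
    -- Vanishing at `g` is a linear condition, so it passes from the basis to the whole span.
    let evg : crossedHomSubmodule N F V →ₗ[F] V :=
      (LinearMap.proj g).comp (Submodule.subtype _)
    have hle : Submodule.span F b ≤ LinearMap.ker evg := Submodule.span_le.mpr hb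
    exact (hπM ⟨M, hM⟩ g).mp (hle hsp)
  · exact le_iInf fun j => sInf_le (f j).2

/-- The affine self-maps of `L ^ r`. -/
def affineSelfMaps (L : Type u) [Field L] (r : ℕ) : Set (Function.End (Fin r → L)) :=
  Set.range fun Ab : Matrix (Fin r) (Fin r) L × (Fin r → L) => fun x => Ab.1.mulVec x + Ab.2

lemma natCard_affineSelfMaps_le (L : Type u) [Field L] [Finite L] (r : ℕ) :
    Nat.card (affineSelfMaps L r) ≤ (Nat.card L ^ r) ^ (r + 1) := by
  refine (Finite.card_range_le _).trans (le_of_eq ?_)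
  rw [Nat.card_prod, Matrix, Nat.card_fun, Nat.card_fun, Nat.card_fin, pow_succ]

/-- The point stabilizers of zero for affine actions of `G` on `L ^ r` that are trivial on `N`. -/
def affineStabilizers (N : Subgroup G) (L : Type u) [Field L] (r : ℕ) : Set (Subgroup G) :=
  {M | ∃ Φ : G →* Function.End (Fin r → L), (∀ n ∈ N, Φ n = 1) ∧
    (∀ g, Φ g ∈ affineSelfMaps L r) ∧ ∀ g, Φ g 0 = 0 ↔ g ∈ M}

lemma finite_and_ncard_affineStabilizers_le {N : Subgroup G} (S : Finset G)
    (hS : Subgroup.closure (S : Set G) ⊔ N = ⊤) (L : Type u) [Field L] [Finite L] (r : ℕ) :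
    (affineStabilizers N L r).Finite ∧
      (affineStabilizers N L r).ncard ≤ ((Nat.card L ^ r) ^ (r + 1)) ^ S.card := by
  choose Φ hΦN hΦ hΦM using fun M : affineStabilizers N L r => M.2
  have hinj : Function.Injective (fun (M : affineStabilizers N L r) (s : S) =>
      (⟨Φ M s, hΦ M s⟩ : affineSelfMaps L r)) := by
    intro M M' h
    have : Φ M = Φ M' := MonoidHom.eq_of_eqOn_dense (closure_union_eq_top hS) (by
      rintro x (hx | hx)
      · exact congrArg Subtype.val (congrFun h ⟨x, hx⟩)
      · rw [hΦN M x hx, hΦN M' x hx])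
    ext x
    rw [← hΦM, ← hΦM, this]
  have : Finite (affineSelfMaps L r) := Set.finite_range _
  have hfin : Finite (affineStabilizers N L r) := Finite.of_injective _ hinj
  refine ⟨hfin, ?_⟩
  have := Nat.card_le_card_of_injective _ hinj
  rw [Nat.card_fun, Nat.card_eq_fintype_card (α := S), Fintype.card_coe,
    Nat.card_coe_set_eq] at this
  exact this.trans (Nat.pow_le_pow_left (natCard_affineSelfMaps_le L r) _)

/-- The action is `x ↦ g x + π g`, with `M` as stabilizer of zero. Transport to `L ^ r` allows
complements of non-isomorphic modules of equal order and dimension to be counted together. -/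
lemma mem_affineStabilizers_of_mem_maximalComplements {H K N M : Subgroup G} [H.Normal] [K.Normal]
    {F V : Type u} [Field F] [AddCommGroup V] [Module (MonoidAlgebra ℤ G) V] [Module F V]
    [SMulCommClass F (MonoidAlgebra ℤ G) V] [Module.Finite F V]
    (hc : IsChiefPair K H) (hab : ⁅H, H⁆ ≤ K) (hV : IsGIsomorphicToFactor H K V)
    (hNK : N ≤ K) (hM : M ∈ maximalComplements K H) (L : Type u) [Field L] (σ : L ≃+* F) :
    M ∈ affineStabilizers N L (Module.finrank F V) := by
  obtain ⟨π, hπ, hπM⟩ := exists_isCrossedHom_of_mem_maximalComplements hc hab hV hM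
  let b := (Module.finBasis F V).equivFun
  let e : V ≃+ (Fin (Module.finrank F V) → L) :=
    b.toAddEquiv.trans (AddEquiv.piCongrRight fun _ => σ.symm.toAddEquiv)
  have he : ∀ (k : L) (v : V), e (σ k • v) = k • e v := by
    intro k v
    ext i
    change σ.symm (b (σ k • v) i) = k * σ.symm (b v i)
    rw [map_smul]
    simp
  have he' : ∀ (k : L) x, e.symm (k • x) = σ k • e.symm x := by
    intro k x
    rw [AddEquiv.symm_apply_eq, he, AddEquiv.apply_symm_apply]
  let Φ : G →* Function.End (Fin (Module.finrank F V) → L) :=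
    { toFun := fun g x => e (MonoidAlgebra.of ℤ G g • e.symm x + π g)
      map_one' := by
        funext x
        have h1 : π 1 = 0 := (hπM 1).mpr M.one_mem
        simp only [map_one, one_smul, h1, add_zero, AddEquiv.apply_symm_apply]
        rfl
      map_mul' := fun g h => by
        funext x
        change _ = e (MonoidAlgebra.of ℤ G g •
          e.symm (e (MonoidAlgebra.of ℤ G h • e.symm x + π h)) + π g)
        simp only [hπ g h, AddEquiv.symm_apply_apply, smul_add, map_mul, mul_smul]
        congr 1
        abel }
  refine ⟨Φ, fun n hn => ?_, fun g => ?_, fun g => ?_⟩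
  · funext x
    change e (MonoidAlgebra.of ℤ G n • e.symm x + π n) = x
    rw [hV.smul_eq_self (hNK hn), (hπM n).mpr (hM.2.1 (hNK hn)), add_zero, e.apply_symm_apply]
  · let A : (Fin (Module.finrank F V) → L) →ₗ[L] (Fin (Module.finrank F V) → L) :=
      { toFun := fun x => e (MonoidAlgebra.of ℤ G g • e.symm x)
        map_add' := fun x y => by simp only [map_add, smul_add]
        map_smul' := fun k x => by
          simp only [he', RingHom.id_apply]
          rw [← he, smul_comm (σ k)] }
    refine ⟨(LinearMap.toMatrix' A, e (π g)), ?_⟩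
    funext x
    change (LinearMap.toMatrix' A).mulVec x + e (π g) = e (MonoidAlgebra.of ℤ G g • e.symm x + π g)
    rw [← Matrix.toLin'_apply, Matrix.toLin'_toMatrix', map_add]
    rfl
  · change e (MonoidAlgebra.of ℤ G g • e.symm 0 + π g) = 0 ↔ _
    rw [map_zero, smul_zero, zero_add, map_eq_zero_iff e e.injective, hπM]

/-- The endomorphism ring of a finite simple module is a finite field. -/
lemma exists_field_of_isSimpleModule {V : Type u} [AddCommGroup V] [Module (MonoidAlgebra ℤ G) V]
    [Finite V] [IsSimpleModule (MonoidAlgebra ℤ G) V] {γ : ℕ}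
    (hγ : Module.rank (Module.End (MonoidAlgebra ℤ G) V) V ≤ (γ : Cardinal)) :
    ∃ (F : Type u) (_ : Field F) (_ : Module F V), Finite F ∧
      SMulCommClass F (MonoidAlgebra ℤ G) V ∧ Module.Finite F V ∧ Module.finrank F V ≤ γ := by
  classical
  have hfin : Finite (Module.End (MonoidAlgebra ℤ G) V) := DFunLike.finite _
  let _ : Field (Module.End (MonoidAlgebra ℤ G) V) := littleWedderburn _
  refine ⟨Module.End (MonoidAlgebra ℤ G) V, inferInstance, Module.End.applyModule, hfin, ?_, ?_, ?_⟩
  · infer_instance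
  · infer_instance
  · exact Module.finrank_le_of_rank_le hγ

end Complements

/-! ### Chief series and the index inequality -/

section ChiefSeries

variable {G : Type u} [Group G]

lemma finite_setOf_le_of_finiteIndex (N : Subgroup G) [N.Normal] [N.FiniteIndex] :
    Finite {L : Subgroup G // N ≤ L} := by
  refine Finite.of_injective
    (fun L : {L : Subgroup G // N ≤ L} => L.1.map (QuotientGroup.mk' N)) ?_
  intro L L' h
  have key : ∀ L : {L : Subgroup G // N ≤ L},
      (L.1.map (QuotientGroup.mk' N)).comap (QuotientGroup.mk' N) = L.1 := fun L => by
    rw [Subgroup.comap_map_eq, QuotientGroup.ker_mk', sup_eq_left.mpr L.2]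
  simp only at h
  exact Subtype.ext (by rw [← key L, ← key L', h])

/-- A chief series of `G` above a normal subgroup of finite index. -/
lemma exists_chief_series (N : Subgroup G) [N.Normal] [N.FiniteIndex] :
    ∃ (l : ℕ) (C : ℕ → Subgroup G), C l = ⊤ ∧ (∀ i, (C i).Normal ∧ N ≤ C i) ∧ C 0 = N ∧
      ∀ i < l, IsChiefPair (C i) (C (i + 1)) := by
  let T := {L : Subgroup G // L.Normal ∧ N ≤ L}
  have := finite_setOf_le_of_finiteIndex N
  have : Finite T := Finite.of_injective
    (fun L : T => (⟨L.1, L.2.2⟩ : {L : Subgroup G // N ≤ L})) (fun L L' h => by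
      exact Subtype.ext (congrArg (fun L => L.1) h))
  have : Nonempty T := ⟨⟨N, inferInstance, le_rfl⟩⟩
  obtain ⟨a, hmin, l, hmax, hcov⟩ := exists_covBy_seq_of_wellFoundedLT_wellFoundedGT T
  refine ⟨l, fun i => (a i).1, ?_, fun i => (a i).2, ?_, fun i hi => ⟨(hcov i hi).1, ?_⟩⟩
  · exact top_le_iff.mp (hmax (b := ⟨⊤, inferInstance, le_top⟩) (show (a l).1 ≤ ⊤ from le_top))
  · exact le_antisymm (hmin (b := ⟨N, inferInstance, le_rfl⟩) (a 0).2.2) (a 0).2.2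
  · intro L hL h1 h2
    by_contra! hne
    exact (hcov i hi).2 (c := ⟨L, hL, (a i).2.2.trans h1⟩)
      (show (a i).1 < L from lt_of_le_of_ne h1 hne.1.symm)
      (show L < (a (i + 1)).1 from lt_of_le_of_ne h2 hne.2)

/-- Otherwise `⁅H, H⁆ ⊔ K = H`, and the image of `H` in the solvable group `G ⧸ K` would be perfect
and nontrivial. -/
lemma IsChiefPair.commutator_le {K H : Subgroup G} [H.Normal] [K.Normal]
    (hc : IsChiefPair K H) (hs : Group.IsSolvable (G ⧸ K)) : ⁅H, H⁆ ≤ K := by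
  have hLH : ⁅H, H⁆ ⊔ K ≤ H := sup_le (Subgroup.commutator_le_left H H) hc.1.le
  rcases hc.2 (⁅H, H⁆ ⊔ K) inferInstance le_sup_right hLH with h | h
  · exact le_sup_left.trans h.le
  · exfalso
    have hK : K.map (QuotientGroup.mk' K) = ⊥ := by
      rw [Subgroup.map_eq_bot_iff, QuotientGroup.ker_mk']
    have h1 : ⁅H.map (QuotientGroup.mk' K), H.map (QuotientGroup.mk' K)⁆ =
        H.map (QuotientGroup.mk' K) := by
      conv_rhs => rw [← h]
      rw [Subgroup.map_sup, hK, sup_bot_eq, Subgroup.map_commutator]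
    have h2 : H.map (QuotientGroup.mk' K) ≠ ⊥ := by
      rw [Ne, Subgroup.map_eq_bot_iff, QuotientGroup.ker_mk']
      exact hc.1.not_ge
    exact (Group.IsSolvable.commutator_lt_of_ne_bot h2).ne h1

lemma chain_le {l : ℕ} {C : ℕ → Subgroup G} (hC : ∀ i < l, IsChiefPair (C i) (C (i + 1)))
    {i j : ℕ} (hij : i ≤ j) (hj : j ≤ l) : C i ≤ C j := by
  induction j, hij using Nat.le_induction with
  | base => exact le_rfl
  | succ j hij ih => exact (ih (by omega)).trans (hC j (by omega)).1.le

lemma exists_mem_maximalComplements {l : ℕ} {C : ℕ → Subgroup G} (hl : C l = ⊤)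
    {M : Subgroup G} (hM : IsCoatom M) (h0 : C 0 ≤ M) :
    ∃ i < l, M ∈ maximalComplements (C i) (C (i + 1)) := by
  classical
  have hex : ∃ j, ¬ C j ≤ M := ⟨l, fun h => hM.1 (top_le_iff.mp (hl ▸ h))⟩
  obtain ⟨i, hi⟩ : ∃ i, Nat.find hex = i + 1 :=
    Nat.exists_eq_succ_of_ne_zero fun h => (h ▸ Nat.find_spec hex) h0
  have hil : Nat.find hex ≤ l := Nat.find_min' hex fun h => hM.1 (top_le_iff.mp (hl ▸ h))
  exact ⟨i, by omega, hM, not_not.mp (Nat.find_min hex (by omega : i < _)),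
    hi ▸ Nat.find_spec hex⟩

/-- Makes one chosen complement per factor an injective choice, so that counting complements bounds
the number of factors. -/
lemma eq_of_mem_maximalComplements {l : ℕ} {C : ℕ → Subgroup G}
    (hC : ∀ i < l, IsChiefPair (C i) (C (i + 1))) {i j : ℕ} (hi : i < l) (hj : j < l)
    {M : Subgroup G} (hMi : M ∈ maximalComplements (C i) (C (i + 1)))
    (hMj : M ∈ maximalComplements (C j) (C (j + 1))) : i = j := by
  rcases lt_trichotomy i j with h | h | h
  · exact absurd ((chain_le hC (Nat.succ_le_of_lt h) hj.le).trans hMj.2.1) hMi.2.2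
  · exact h
  · exact absurd ((chain_le hC (Nat.succ_le_of_lt h) hi.le).trans hMi.2.1) hMj.2.2

/-- The product of the orders of the chief factors avoided by maximal subgroups above `U` is at
most the index of `U`. -/
lemma prod_relIndex_le_index {l : ℕ} {C : ℕ → Subgroup G} (hl : C l = ⊤)
    (hC : ∀ i < l, IsChiefPair (C i) (C (i + 1))) (hn : ∀ i, (C i).Normal)
    (hab : ∀ i < l, ⁅C (i + 1), C (i + 1)⁆ ≤ C i) (U : Subgroup G) [U.FiniteIndex]
    (I : Finset ℕ)
    (hI : ∀ i ∈ I, i < l ∧ ∃ M ∈ maximalComplements (C i) (C (i + 1)), U ≤ M) :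
    ∏ i ∈ I, (C i).relIndex (C (i + 1)) ≤ U.index := by
  -- The index is filtered through the chain `U ⊔ C k`. For `k ∈ I`, a complement `M ≥ U` contains
  -- `U ⊔ C k`, so `(U ⊔ C k) ⊓ C (k + 1) ≤ C k` and the step from `k` to `k + 1` contributes at
  -- least the order of the factor.
  have key : ∀ k ≤ l, ∏ i ∈ I with i < k, (C i).relIndex (C (i + 1)) ≤ U.relIndex (U ⊔ C k) := by
    intro k
    induction k with
    | zero =>
      intro _
      have : (U.subgroupOf (U ⊔ C 0)).FiniteIndex := inferInstance
      have h0 : U.relIndex (U ⊔ C 0) ≠ 0 := this.index_ne_zero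
      simpa [Nat.one_le_iff_ne_zero] using h0
    | succ k ih =>
      intro hk
      have hle : U ⊔ C k ≤ U ⊔ C (k + 1) := sup_le_sup_left (hC k hk).1.le U
      rw [← Subgroup.relIndex_mul_relIndex U _ _ le_sup_left hle]
      have hpos : ∀ K : Subgroup G, (U ⊔ C k).relIndex K ≠ 0 := by
        have : (U ⊔ C k).FiniteIndex := Subgroup.finiteIndex_of_le le_sup_left
        intro K
        have : ((U ⊔ C k).subgroupOf K).FiniteIndex := inferInstance
        exact this.index_ne_zero
      by_cases hkI : k ∈ I
      · have hins : I.filter (· < k + 1) = insert k (I.filter (· < k)) := by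
          ext i
          simp only [Finset.mem_filter, Finset.mem_insert]
          constructor
          · rintro ⟨h1, h2⟩
            rcases Nat.lt_succ_iff_lt_or_eq.mp h2 with h | h
            · exact Or.inr ⟨h1, h⟩
            · exact Or.inl h
          · rintro (rfl | ⟨h1, h2⟩)
            · exact ⟨hkI, Nat.lt_succ_self _⟩
            · exact ⟨h1, by omega⟩
        rw [hins, Finset.prod_insert (by simp), mul_comm]
        refine Nat.mul_le_mul (ih (by omega)) ?_
        obtain ⟨-, M, hM, hUM⟩ := hI k hkI
        have := hn k
        have := hn (k + 1)
        have hinf : (U ⊔ C k) ⊓ C (k + 1) ≤ C k := by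
          exact (inf_le_inf_right _ (sup_le hUM hM.2.1)).trans
            (inf_eq_of_mem_maximalComplements (hC k hk) (hab k hk) hM).le
        calc (C k).relIndex (C (k + 1))
            ≤ ((U ⊔ C k) ⊓ C (k + 1)).relIndex (C (k + 1)) :=
              Subgroup.relIndex_le_of_le_left hinf (by
                rw [Subgroup.inf_relIndex_right]; exact hpos _)
          _ = (U ⊔ C k).relIndex (C (k + 1)) := Subgroup.inf_relIndex_right _ _
          _ ≤ _ := Subgroup.relIndex_le_of_le_right le_sup_right (hpos _)
      · have hins : I.filter (· < k + 1) = I.filter (· < k) := by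
          ext i
          simp only [Finset.mem_filter]
          refine and_congr_right fun h1 => ⟨fun h2 => ?_, fun h2 => by omega⟩
          exact lt_of_le_of_ne (by omega) fun h => hkI (h ▸ h1)
        rw [hins]
        exact (ih (by omega)).trans (Nat.le_mul_of_pos_right _ (Nat.pos_of_ne_zero (hpos _)))
  have h := key l le_rfl
  rw [hl, sup_top_eq, Subgroup.relIndex_top_right] at h
  rwa [Finset.filter_true_of_mem fun i hi => (hI i hi).1] at h

end ChiefSeries

/-! ### An Euler product estimate -/

section Counting

/-- Grouped by value, the weights equal to `m` contribute at most `m^c / m^(c+2) = m^(-2)`, and the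
sum of `m^(-2)` over `m ≥ 2` is at most 1. -/
lemma sum_inv_pow_le_one {J : Finset ℕ} {w : ℕ → ℕ} (hw : ∀ i ∈ J, 2 ≤ w i) {c : ℕ}
    (hc : ∀ m, 2 ≤ m → (J.filter (w · = m)).card ≤ m ^ c) :
    ∑ i ∈ J, (((w i : ℕ) : ℝ) ^ (c + 2))⁻¹ ≤ 1 := by
  rw [Finset.sum_comp (fun m : ℕ => ((m : ℝ) ^ (c + 2))⁻¹) w]
  have h1 : ∀ m ∈ J.image w, (J.filter (w · = m)).card • ((m : ℝ) ^ (c + 2))⁻¹ ≤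
      ((m : ℝ) ^ 2)⁻¹ := by
    intro m hm
    obtain ⟨i, hi, rfl⟩ := Finset.mem_image.mp hm
    have h2 := hw i hi
    have hpos : (0 : ℝ) < w i := by exact_mod_cast (by omega : 0 < w i)
    rw [nsmul_eq_mul, pow_add, mul_inv, ← mul_assoc]
    refine mul_le_of_le_one_left (by positivity) ?_
    rw [← div_eq_mul_inv, div_le_one (by positivity)]
    exact_mod_cast hc _ h2
  refine (Finset.sum_le_sum h1).trans ?_
  have hsub : J.image w ⊆ Finset.Ioo 1 ((J.image w).sup id + 1) := by
    intro m hm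
    have h3 : m ≤ (J.image w).sup id := Finset.le_sup (f := id) hm
    obtain ⟨i, hi, rfl⟩ := Finset.mem_image.mp hm
    exact Finset.mem_Ioo.mpr ⟨hw i hi, by omega⟩
  refine (Finset.sum_le_sum_of_subset_of_nonneg hsub fun _ _ _ => by positivity).trans ?_
  refine (sum_Ioo_inv_sq_le 1 _).trans ?_
  norm_num

/-- If at most `m ^ c` of the weights equal `m`, then summing powers of the weight products over
all index sets of weight product at most `n` gives a polynomial bound. -/
lemma sum_prod_pow_le {J : Finset ℕ} {w : ℕ → ℕ} (hw : ∀ i ∈ J, 2 ≤ w i) {c : ℕ}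
    (hc : ∀ m, 2 ≤ m → (J.filter (w · = m)).card ≤ m ^ c) (e : ℕ) {n : ℕ} (hn : 2 ≤ n) :
    ∑ I ∈ J.powerset with ∏ i ∈ I, w i ≤ n, ∏ i ∈ I, w i ^ e ≤ n ^ (e + c + 4) := by
  have hn0 : (0 : ℝ) < n := by exact_mod_cast (by omega : 0 < n)
  -- Rankin's trick: `∏ w_i ≤ n` gives `∏ w_i^(e+c+2) ≤ n^(e+c+2)`. The remaining sum is then
  -- extended to all subsets of `J`, where it factors as `∏ (1 + w_i^(-(c+2))) ≤ exp 1 < 4 ≤ n^2`.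
  have h1 : ∀ I ∈ J.powerset.filter (fun I => ∏ i ∈ I, w i ≤ n),
      ((∏ i ∈ I, w i ^ e : ℕ) : ℝ) ≤
        (n : ℝ) ^ (e + c + 2) * ∏ i ∈ I, (((w i : ℕ) : ℝ) ^ (c + 2))⁻¹ := by
    intro I hI
    rw [Finset.mem_filter, Finset.mem_powerset] at hI
    have hpos : (0 : ℝ) < ((∏ i ∈ I, w i : ℕ) : ℝ) := by
      exact_mod_cast Finset.prod_pos fun i hi => by have := hw i (hI.1 hi); omega
    have hle : ((∏ i ∈ I, w i : ℕ) : ℝ) ≤ n := by exact_mod_cast hI.2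
    rw [Finset.prod_inv_distrib, Finset.prod_pow, Finset.prod_pow, ← div_eq_mul_inv,
      ← Nat.cast_prod, le_div_iff₀ (by positivity), Nat.cast_pow, ← pow_add]
    exact pow_le_pow_left₀ hpos.le hle _
  have h2 : ((∑ I ∈ J.powerset with ∏ i ∈ I, w i ≤ n, ∏ i ∈ I, w i ^ e : ℕ) : ℝ) ≤
      (n : ℝ) ^ (e + c + 2) * 4 := by
    rw [Nat.cast_sum]
    refine (Finset.sum_le_sum h1).trans ?_
    rw [← Finset.mul_sum]
    refine mul_le_mul_of_nonneg_left ?_ (by positivity)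
    refine (Finset.sum_le_sum_of_subset_of_nonneg (Finset.filter_subset _ _)
      fun _ _ _ => by positivity).trans ?_
    rw [← Finset.prod_one_add]
    refine (Real.prod_one_add_le_exp_sum J fun _ => by positivity).trans ?_
    refine (Real.exp_le_exp.mpr (sum_inv_pow_le_one hw hc)).trans ?_
    exact (Real.exp_one_lt_d9.le).trans (by norm_num)
  have h3 : ∑ I ∈ J.powerset with ∏ i ∈ I, w i ≤ n, ∏ i ∈ I, w i ^ e ≤ n ^ (e + c + 2) * 4 := by
    exact_mod_cast h2
  refine h3.trans ?_
  rw [show e + c + 4 = (e + c + 2) + 2 by ring, pow_add n (e + c + 2) 2]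
  exact Nat.mul_le_mul_left _ (by nlinarith)

end Counting

/-! ### Counting intersections above a fixed normal subgroup -/

section Bounds

variable {G : Type u} [Group G]

/-- The quantitative information on the maximal subgroups avoiding an abelian chief factor whose
dimension over its endomorphism field is at most `γ`. -/
structure HasFactorBounds (N K H : Subgroup G) (d γ : ℕ) : Prop where
  two_le : 2 ≤ K.relIndex H
  finite : (maximalComplements K H).Finite
  ncard_le : (maximalComplements K H).ncard ≤ K.relIndex H ^ d
  exists_iInf : ∀ Γ ⊆ maximalComplements K H, Γ.Nonempty →
    ∃ f : Fin (d * γ + 1) → Subgroup G, (∀ j, f j ∈ Γ) ∧ ⨅ j, f j = sInf Γ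
  exists_field : ∃ r ≤ γ, (∃ (F : Type u) (_ : Field F), Finite F ∧ Nat.card F ^ r = K.relIndex H) ∧
    ∀ (L : Type u) [Field L] [Finite L], Nat.card L ^ r = K.relIndex H →
      maximalComplements K H ⊆ affineStabilizers N L r

lemma hasFactorBounds {H K N : Subgroup G} [H.Normal] [K.Normal] [K.FiniteIndex]
    (hc : IsChiefPair K H) (hab : ⁅H, H⁆ ≤ K) (hNK : N ≤ K) (S : Finset G)
    (hS : Subgroup.closure (S : Set G) ⊔ N = ⊤) {γ : ℕ}
    (hγ : ∀ (V : Type u) [AddCommGroup V] [Module (MonoidAlgebra ℤ G) V],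
      IsSimpleModule (MonoidAlgebra ℤ G) V → IsGIsomorphicToFactor H K V →
      Module.rank (Module.End (MonoidAlgebra ℤ G) V) V ≤ (γ : Cardinal)) :
    HasFactorBounds N K H S.card γ := by
  obtain ⟨V, _, _, hV⟩ := exists_module_isGIsomorphicToFactor H K hab
  have hsimple := hc.isSimpleModule hV
  have hcard := hV.natCard_eq
  have hpos : K.relIndex H ≠ 0 := by
    have : (K.subgroupOf H).FiniteIndex := inferInstance
    exact this.index_ne_zero
  have : Finite V := Nat.finite_of_card_ne_zero (hcard ▸ hpos)
  have : Nontrivial V := IsSimpleModule.nontrivial (MonoidAlgebra ℤ G) V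
  obtain ⟨F, _, _, _, _, _, hF⟩ := exists_field_of_isSimpleModule (hγ V hsimple hV)
  have h2 : 2 ≤ K.relIndex H := hcard ▸ Finite.one_lt_card
  obtain ⟨hfin, hle⟩ := finite_and_ncard_maximalComplements_le hc hab hV hNK S hS
  have hFcard : Nat.card F ^ Module.finrank F V = K.relIndex H := by
    rw [← hcard, Module.natCard_eq_pow_finrank (K := F) (V := V)]
  refine ⟨h2, hfin, hcard ▸ hle, fun Γ hΓ hne =>
    exists_iInf_eq_sInf_of_subset_maximalComplements hc hab hV hNK S hS hF hΓ hne,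
    Module.finrank F V, hF, ⟨F, inferInstance, inferInstance, hFcard⟩, fun L _ _ hL M hM => ?_⟩
  -- A nonzero exponent forces `L` and `F` to have equal order, hence to be isomorphic finite
  -- fields.
  have hr : Module.finrank F V ≠ 0 := by
    intro h
    rw [h, pow_zero] at hFcard
    omega
  have hLF : Nat.card L = Nat.card F := Nat.pow_left_injective hr (hL.trans hFcard.symm)
  have := Fintype.ofFinite L
  have := Fintype.ofFinite F
  rw [Nat.card_eq_fintype_card, Nat.card_eq_fintype_card] at hLF
  exact mem_affineStabilizers_of_mem_maximalComplements hc hab hV hNK hM L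
    (FiniteField.ringEquivOfCardEq hLF)

/-- In a chief series, the number of complemented factors of order `m` is polynomially bounded. -/
lemma card_filter_relIndex_eq_le {l : ℕ} {C : ℕ → Subgroup G} {N : Subgroup G}
    (hC : ∀ i < l, IsChiefPair (C i) (C (i + 1))) (S : Finset G)
    (hS : Subgroup.closure (S : Set G) ⊔ N = ⊤) {γ : ℕ} {J : Finset ℕ}
    (hJ : ∀ i ∈ J, i < l ∧ (maximalComplements (C i) (C (i + 1))).Nonempty ∧
      HasFactorBounds N (C i) (C (i + 1)) S.card γ) {m : ℕ} (hm : 2 ≤ m) :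
    (J.filter fun i => (C i).relIndex (C (i + 1)) = m).card ≤ m ^ (γ + (γ + 1) * S.card) := by
  classical
  choose! M hM using fun i hi => (hJ i hi).2.1
  choose! r hr hF hL using fun i hi => (hJ i hi).2.2.exists_field
  -- Factors of order `m` are split by dimension `b`. The field found for one of them serves all,
  -- since `|F|^b = m` throughout.
  have hfib : ∀ b ∈ Finset.range (γ + 1),
      ((J.filter fun i => (C i).relIndex (C (i + 1)) = m).filter (r · = b)).card ≤
        m ^ ((γ + 1) * S.card) := by
    intro b hb
    rcases Finset.eq_empty_or_nonempty
      ((J.filter fun i => (C i).relIndex (C (i + 1)) = m).filter (r · = b)) with h0 | ⟨i₀, hi₀⟩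
    · rw [h0, Finset.card_empty]; exact Nat.zero_le _
    · simp only [Finset.mem_filter] at hi₀
      obtain ⟨⟨hi₀J, hi₀m⟩, hi₀r⟩ := hi₀
      obtain ⟨F, _, _, hFcard⟩ := hF i₀ hi₀J
      rw [hi₀m, hi₀r] at hFcard
      obtain ⟨hfin, hle⟩ := finite_and_ncard_affineStabilizers_le S hS F b
      rw [hFcard, ← pow_mul] at hle
      have hinj : ((J.filter fun i => (C i).relIndex (C (i + 1)) = m).filter (r · = b)).card ≤
          hfin.toFinset.card := by
        refine Finset.card_le_card_of_injOn M (fun i hi => ?_) (fun i hi j hj hij => ?_)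
        · simp only [Finset.coe_filter, Finset.mem_filter, Set.mem_ofPred_eq] at hi
          obtain ⟨⟨hiJ, him⟩, rfl⟩ := hi
          rw [Finset.mem_coe, Set.Finite.mem_toFinset]
          exact hL i hiJ F (hFcard.trans him.symm) (hM i hiJ)
        · simp only [Finset.coe_filter, Finset.mem_filter, Set.mem_ofPred_eq] at hi hj
          have hMj := hM j hj.1.1
          rw [← hij] at hMj
          exact eq_of_mem_maximalComplements hC (hJ i hi.1.1).1 (hJ j hj.1.1).1 (hM i hi.1.1) hMj
      rw [← Set.ncard_eq_toFinset_card _ hfin] at hinj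
      refine hinj.trans (hle.trans (Nat.pow_le_pow_right (by omega) ?_))
      exact Nat.mul_le_mul_right _ (Finset.mem_range.mp hb)
  have h1 := Finset.card_le_mul_card_image_of_maps_to (f := r)
    (fun i hi => Finset.mem_range.mpr (Nat.lt_succ_of_le (hr i (Finset.mem_filter.mp hi).1)))
    _ hfib
  rw [Finset.card_range] at h1
  refine h1.trans ?_
  rw [pow_add, mul_comm]
  refine Nat.mul_le_mul_right _ ?_
  -- The `γ + 1` possible dimensions cost a factor `γ + 1 ≤ 2^γ ≤ m^γ`.
  exact (Nat.lt_pow_self (by omega : 1 < 2) : γ < 2 ^ γ).trans_le (Nat.pow_le_pow_left hm γ)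

/-- The subgroups of index `n` above `N` that are intersections of maximal subgroups. -/
lemma card_maximal_intersections_le {l : ℕ} {C : ℕ → Subgroup G} {N : Subgroup G}
    (hl : C l = ⊤) (h0 : C 0 = N) (hn : ∀ i, (C i).Normal)
    (hC : ∀ i < l, IsChiefPair (C i) (C (i + 1)))
    (hab : ∀ i < l, ⁅C (i + 1), C (i + 1)⁆ ≤ C i)
    (S : Finset G) (hS : Subgroup.closure (S : Set G) ⊔ N = ⊤) {γ : ℕ}
    (hJ : ∀ i < l, (maximalComplements (C i) (C (i + 1))).Nonempty →
      HasFactorBounds N (C i) (C (i + 1)) S.card γ)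
    {n : ℕ} (hn2 : 2 ≤ n) (𝓕 : Finset (Subgroup G))
    (h𝓕 : ∀ U ∈ 𝓕, N ≤ U ∧ U.index = n ∧
      ∃ T : Set (Subgroup G), (∀ M ∈ T, IsCoatom M) ∧ U = sInf T) :
    𝓕.card ≤ n ^ (S.card * (S.card * γ + 1) + (γ + (γ + 1) * S.card) + 4) := by
  classical
  set D := S.card * γ + 1 with hD
  let w : ℕ → ℕ := fun i => (C i).relIndex (C (i + 1))
  let J := (Finset.range l).filter fun i => (maximalComplements (C i) (C (i + 1))).Nonempty
  have hJmem : ∀ i ∈ J, i < l ∧ (maximalComplements (C i) (C (i + 1))).Nonempty ∧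
      HasFactorBounds N (C i) (C (i + 1)) S.card γ := fun i hi => by
    obtain ⟨h1, h2⟩ := Finset.mem_filter.mp hi
    exact ⟨Finset.mem_range.mp h1, h2, hJ i (Finset.mem_range.mp h1) h2⟩
  let Γ : Subgroup G → ℕ → Set (Subgroup G) := fun U i =>
    {M | M ∈ maximalComplements (C i) (C (i + 1)) ∧ U ≤ M}
  let I : Subgroup G → Finset ℕ := fun U => J.filter fun i => (Γ U i).Nonempty
  have hmaps : ∀ U ∈ 𝓕, I U ∈ J.powerset.filter (fun I => ∏ i ∈ I, w i ≤ n) := by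
    intro U hU
    rw [Finset.mem_filter, Finset.mem_powerset]
    refine ⟨Finset.filter_subset _ _, ?_⟩
    obtain ⟨-, hindex, -⟩ := h𝓕 U hU
    have : U.FiniteIndex := ⟨by omega⟩
    rw [← hindex]
    refine prod_relIndex_le_index hl hC hn hab U _ fun i hi => ?_
    obtain ⟨h1, M, hM⟩ := Finset.mem_filter.mp hi
    exact ⟨(hJmem i h1).1, M, hM⟩
  have hfiber : ∀ A ∈ J.powerset.filter (fun I => ∏ i ∈ I, w i ≤ n),
      (𝓕.filter (I · = A)).card ≤ ∏ i ∈ A, w i ^ (S.card * D) := by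
    intro A hA
    have hAJ : A ⊆ J := Finset.mem_powerset.mp (Finset.mem_filter.mp hA).1
    have hex : ∀ (U : {U // U ∈ 𝓕.filter (I · = A)}) (i : A),
        ∃ f : Fin D → Subgroup G, (∀ j, f j ∈ Γ U i) ∧ ⨅ j, f j = sInf (Γ U i) := by
      intro U i
      have hi : (i : ℕ) ∈ I U := by
        rw [(Finset.mem_filter.mp U.2).2]; exact i.2
      exact (hJmem i (hAJ i.2)).2.2.exists_iInf _ (fun M hM => hM.1) (Finset.mem_filter.mp hi).2
    choose f hf hfinf using hex
    -- Each maximal subgroup above `U` complements some factor indexed by `A`, hence contains the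
    -- intersection of the complements chosen there.
    have hU : ∀ U : {U // U ∈ 𝓕.filter (I · = A)}, U.1 = ⨅ i : A, ⨅ j, f U i j := by
      intro U
      obtain ⟨hU𝓕, hUA⟩ := Finset.mem_filter.mp U.2
      refine le_antisymm (le_iInf fun i => le_iInf fun j => (hf U i j).2) ?_
      obtain ⟨hNU, -, T, hT, hUT⟩ := h𝓕 U.1 hU𝓕
      conv_rhs => rw [hUT]
      refine le_sInf fun M hM => ?_
      have hUM : U.1 ≤ M := hUT.le.trans (sInf_le hM)
      obtain ⟨i, hil, hMi⟩ := exists_mem_maximalComplements hl (hT M hM) (h0 ▸ hNU.trans hUM)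
      have hiA : i ∈ A := by
        rw [← hUA]
        exact Finset.mem_filter.mpr
          ⟨Finset.mem_filter.mpr ⟨Finset.mem_range.mpr hil, M, hMi⟩, M, hMi, hUM⟩
      refine (iInf_le _ ⟨i, hiA⟩).trans ?_
      rw [hfinf]
      exact sInf_le ⟨hMi, hUM⟩
    have hfinite : ∀ i : A, Finite (maximalComplements (C i) (C (i + 1))) :=
      fun i => (hJmem i (hAJ i.2)).2.2.finite
    let code : {U // U ∈ 𝓕.filter (I · = A)} →
        ∀ i : A, Fin D → maximalComplements (C i) (C (i + 1)) :=
      fun U i j => ⟨f U i j, (hf U i j).1⟩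
    have hinj : Function.Injective code := by
      intro U U' h
      refine Subtype.ext ?_
      rw [hU U, hU U']
      refine iInf_congr fun i => iInf_congr fun j => ?_
      exact congrArg Subtype.val (congrFun (congrFun h i) j)
    have hcard := Nat.card_le_card_of_injective _ hinj
    rw [Nat.card_pi, Nat.card_eq_fintype_card, Fintype.card_coe] at hcard
    refine hcard.trans ?_
    rw [← Finset.prod_coe_sort A fun i => w i ^ (S.card * D)]
    refine Finset.prod_le_prod' fun i _ => ?_
    rw [Nat.card_fun, Nat.card_fin, Nat.card_coe_set_eq, pow_mul]
    exact Nat.pow_le_pow_left (hJmem i (hAJ i.2)).2.2.ncard_le _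
  rw [Finset.card_eq_sum_card_fiberwise hmaps]
  refine (Finset.sum_le_sum hfiber).trans ?_
  exact sum_prod_pow_le (fun i hi => (hJmem i hi).2.2.two_le)
    (fun m hm => card_filter_relIndex_eq_le hC S hS hJmem hm) _ hn2

end Bounds

/-! ### Reduction to open normal subgroups -/

section Topology

variable {G : Type u} [Group G] [TopologicalSpace G]

lemma closure_sup_eq_top_of_dense [IsTopologicalGroup G] {S : Set G}
    (hS : Dense ((Subgroup.closure S : Subgroup G) : Set G)) {N : Subgroup G}
    (hN : IsOpen (N : Set G)) : Subgroup.closure S ⊔ N = ⊤ := by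
  have hopen : IsOpen ((Subgroup.closure S ⊔ N : Subgroup G) : Set G) :=
    Subgroup.isOpen_mono le_sup_right hN
  have hclosed := Subgroup.isClosed_of_isOpen _ hopen
  rw [← SetLike.coe_set_eq, Subgroup.coe_top, ← hclosed.closure_eq]
  exact (hS.mono (SetLike.coe_subset_coe.mpr le_sup_left)).closure_eq

/-- The normal core of the intersection is closed of finite index, hence open. -/
lemma exists_open_normal_le [IsTopologicalGroup G] [CompactSpace G] (𝓕 : Finset (Subgroup G))
    (h𝓕 : ∀ U ∈ 𝓕, IsOpen (U : Set G)) :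
    ∃ N : Subgroup G, N.Normal ∧ N.FiniteIndex ∧ IsOpen (N : Set G) ∧ ∀ U ∈ 𝓕, N ≤ U := by
  let W : Subgroup G := ⨅ U ∈ 𝓕, U
  have hW : IsOpen (W : Set G) := by
    simp only [W, Subgroup.coe_iInf]
    exact isOpen_biInter_finset h𝓕
  have := Subgroup.quotient_finite_of_isOpen W hW
  have : W.FiniteIndex := Subgroup.finiteIndex_of_finite_quotient
  refine ⟨W.normalCore, inferInstance, inferInstance, ?_, fun U hU => ?_⟩
  · exact Subgroup.isOpen_of_isClosed_of_finiteIndex _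
      (W.normalCore_isClosed (Subgroup.isClosed_of_isOpen _ hW))
  · exact W.normalCore_le.trans (iInf₂_le U hU)

end Topology

/-! ### The polynomial bound for the profinite group -/

theorem mainTheorem6 (G : Type u) [Group G] [TopologicalSpace G]
    (hG : IsProsolvable G) (hfg : IsTopologicallyFG G)
    (hγ : ∃ γ : ℕ, ∀ (V : Type u) [AddCommGroup V] [Module (MonoidAlgebra ℤ G) V],
      IsSimpleModule (MonoidAlgebra ℤ G) V →
      (∃ (H K : Subgroup G) (_ : H.Normal) (_ : K.Normal),
        IsChiefFactor H K ∧ IsComplementedFactor H K ∧ IsGIsomorphicToFactor H K V) →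
      Module.rank (Module.End (MonoidAlgebra ℤ G) V) V ≤ (γ : Cardinal)) :
    ∃ β : ℕ, ∀ n : ℕ, 0 < n →
      maximalIntersectionCount G n ≤ ((n ^ β : ℕ) : ℕ∞) := by
  have := hG.isTopologicalGroup
  have := hG.compactSpace
  obtain ⟨S, hS⟩ := hfg
  obtain ⟨γ, hγ⟩ := hγ
  refine ⟨S.card * (S.card * γ + 1) + (γ + (γ + 1) * S.card) + 4, fun n hn => ?_⟩
  -- Index 1 is separate because the estimate absorbs a constant 4 into `n^2`.
  rcases Nat.lt_or_ge n 2 with hlt | hn2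
  · obtain rfl : n = 1 := by omega
    rw [one_pow, Nat.cast_one, maximalIntersectionCount, Set.encard_le_one_iff]
    rintro U U' ⟨-, h, -⟩ ⟨-, h', -⟩
    rw [Subgroup.index_eq_one.mp h, Subgroup.index_eq_one.mp h']
  by_contra! hcon
  -- Finiteness of the whole set is not known in advance, so a subset with one element too many is
  -- taken; being finite, it has a common open normal subgroup below it.
  obtain ⟨X, hX, hXcard⟩ := Set.exists_subset_encard_eq
    (Order.add_one_le_of_lt hcon)
  have hXfin : X.Finite := Set.finite_of_encard_eq_coe (k := _ + 1) (by
    rw [hXcard]; push_cast; rfl)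
  obtain ⟨N, hNn, _, hNo, hNU⟩ := exists_open_normal_le hXfin.toFinset fun U hU =>
    (hX (hXfin.mem_toFinset.mp hU)).1
  have hopen : ∀ L : Subgroup G, N ≤ L → IsOpen (L : Set G) := fun L hL =>
    Subgroup.isOpen_mono hL hNo
  have hclosed : ∀ L : Subgroup G, N ≤ L → IsClosed (L : Set G) := fun L hL =>
    Subgroup.isClosed_of_isOpen _ (hopen L hL)
  have hSN := closure_sup_eq_top_of_dense hS hNo
  obtain ⟨l, C, hl, hCN, h0, hC⟩ := exists_chief_series N
  have hnorm : ∀ i, (C i).Normal := fun i => (hCN i).1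
  have hab : ∀ i < l, ⁅C (i + 1), C (i + 1)⁆ ≤ C i := fun i hi =>
    (hC i hi).commutator_le (hG.isSolvable_quotient (C i) (hopen _ (hCN i).2))
  have hbounds : ∀ i < l, (maximalComplements (C i) (C (i + 1))).Nonempty →
      HasFactorBounds N (C i) (C (i + 1)) S.card γ := by
    rintro i hi ⟨M, hM⟩
    have : (C i).FiniteIndex := Subgroup.finiteIndex_of_le (hCN i).2
    refine hasFactorBounds (hC i hi) (hab i hi) (hCN i).2 S hSN fun V _ _ hV hiso => ?_
    -- The maximal subgroup `M` itself witnesses that the factor is complemented.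
    refine hγ V hV ⟨C (i + 1), C i, hnorm _, hnorm _, ?_, ⟨M, ?_, ?_, ?_⟩, hiso⟩
    · exact ⟨hnorm _, hnorm _, hclosed _ (hCN _).2, hclosed _ (hCN _).2, (hC i hi).1,
        fun L hL _ => (hC i hi).2 L hL⟩
    · exact hclosed M ((hCN i).2.trans hM.2.1)
    · exact sup_eq_top_of_mem_maximalComplements hM
    · exact inf_eq_of_mem_maximalComplements (hC i hi) (hab i hi) hM
  have hle := card_maximal_intersections_le hl h0 hnorm hC hab S hSN hbounds hn2 hXfin.toFinset
    fun U hU => ⟨hNU U hU, (hX (hXfin.mem_toFinset.mp hU)).2⟩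
  rw [hXfin.encard_eq_coe_toFinset_card] at hXcard
  have hXcard' := (by exact_mod_cast hXcard : hXfin.toFinset.card = _ + 1)
  omega
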